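/- Let $\mathbb F$ be an algebraically closed field and $d\ge 0$ an integer. A square matrix is irreducible tridiagonal if all its nonzero entries lie on the diagonal, subdiagonal or superdiagonal and all sub- and superdiagonal entries are nonzero. A Leonard pair on a $(d+1)$-dimensional vector space $V$ over $\mathbb F$ is an ordered pair of linear maps $A,A^*:V\to V$ such that some basis of $V$ makes $A$ irreducible tridiagonal and $A^*$ diagonal, and some basis of $V$ makes $A^*$ irreducible tridiagonal and $A$ diagonal. Matrices $A,A^*\in\mathrm{Mat}_{d+1}(\mathbb F)$ form an LB-TD Leonard pair if they act on $\mathbb F^{d+1}$ as a Leonard pair, $A$ is lower bidiagonal with all subdiagonal entries $1$, and $A^*$ is irreducible tridiagonal. For a Leonard pair $A,A^*$ (whose members each have $d+1$ distinct eigenvalues), an ordering $\{\theta_i\}_{i=0}^d$ of the eigenvalues of $A$ is standard if $A^*$ is irreducible tridiagonal with respect to a basis $\{v_i\}_{i=0}^d$ with $Av_i=\theta_iv_i$; a standard ordering $\{\theta^*_i\}_{i=0}^d$ of the eigenvalues of $A^*$ is defined in the same way with $A$ and $A^*$ exchanged. The first split sequence associated with $(\{\theta_i\},\{\theta^*_i\})$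 is the (unique) sequence $\{\varphi_i\}_{i=1}^d$ such that for some basis of $V$ the map $A$ is represented by the lower bidiagonal matrix with diagonal $\theta_0,\dots,\theta_d$ and all subdiagonal entries $1$, and $A^*$ by the upper bidiagonal matrix with diagonal $\theta^*_0,\dots,\theta^*_d$ and superdiagonal $\varphi_1,\dots,\varphi_d$. The second split sequence $\{\phi_i\}_{i=1}^d$ is the first split sequence associated with $(\{\theta_{d-i}\},\{\theta^*_i\})$. A parameter array of $A,A^*$ is a sequence $(\{\theta_i\}_{i=0}^d,\{\theta^*_i\}_{i=0}^d,\{\varphi_i\}_{i=1}^d,\{\phi_i\}_{i=1}^d)$ consisting of standard orderings of the eigenvalues of $A$ and of $A^*$ and the associated first and second split sequences. **Proposition.** Let $q\in\mathbb F$ be nonzero and not a root of unity, and let $\alpha,\alpha^*,a,a',b,b',c\in\mathbb F$ with $c\ne0$. Define \begin{align*} \theta_i&=\alpha+aq^{2i-d}+a'q^{d-2i} && (0\le i\le d),\\ x_i&=\alpha^*+(b+b')q^{d-2i}+a'c\,q^{d-2i}\bigl(q^{d+1}+q^{-d-1}-q^{d-2i-1}-q^{d-2i+1}\bigr) && (0\le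 i\le d),\\ y_i&=(q^i-q^{-i})(q^{d-i+1}-q^{i-d-1})(b-a'cq^{d-2i+1})(b'-a'cq^{d-2i+1})c^{-1} && (1\le i\le d),\\ z_i&=-cq^{d-2i+1} && (1\le i\le d). \end{align*} Let $A$ be the lower bidiagonal matrix with diagonal $\theta_0,\dots,\theta_d$ and all subdiagonal entries $1$, and let $A^*$ be the tridiagonal matrix with diagonal $x_0,\dots,x_d$, superdiagonal $y_1,\dots,y_d$ and subdiagonal $z_1,\dots,z_d$. Assume that $A,A^*$ is an LB-TD Leonard pair in $\mathrm{Mat}_{d+1}(\mathbb F)$. Define \begin{align*} \theta^*_i&=\alpha^*+bq^{2i-d}+b'q^{d-2i} && (0\le i\le d),\\ \varphi_i&=(q^i-q^{-i})(q^{d-i+1}-q^{i-d-1})(b-a'cq^{d-2i+1})(b'-acq^{2i-d-1})c^{-1} && (1\le i\le d),\\ \phi_i&=(q^i-q^{-i})(q^{d-i+1}-q^{i-d-1})(b-acq^{d-2i+1})(b'-a'cq^{2i-d-1})c^{-1} && (1\le i\le d). \end{align*} Then $(\{\theta_i\}_{i=0}^d,\{\theta^*_i\}_{i=0}^d,\{\varphi_i\}_{i=1}^d,\{\phi_i\}_{i=1}^d)$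 is a parameter array of $A,A^*$. -/

import Mathlib

/-- A square matrix `M`, with rows and columns indexed by `0, …, d`, is irreducible tridiagonal:
each nonzero entry lies on the diagonal, the subdiagonal or the superdiagonal, and each entry on
the subdiagonal and each entry on the superdiagonal is nonzero. -/
def IsIrreducibleTridiagonal {F : Type*} [Field F] {d : ℕ}
    (M : Matrix (Fin (d + 1)) (Fin (d + 1)) F) : Prop :=
  (∀ i j : Fin (d + 1), (i : ℕ) ≠ j → (i : ℕ) ≠ j + 1 → (i : ℕ) + 1 ≠ j → M i j = 0) ∧
  (∀ i j : Fin (d + 1), (i : ℕ) = j + 1 ∨ (i : ℕ) + 1 = j → M i j ≠ 0)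

/-- A Leonard pair on a vector space `V` of dimension `d + 1` over `F`. -/
def IsLeonardPair {F V : Type*} [Field F] [AddCommGroup V] [Module F V] (d : ℕ)
    (A As : Module.End F V) : Prop :=
  (∃ v : Module.Basis (Fin (d + 1)) F V,
    IsIrreducibleTridiagonal (LinearMap.toMatrix v v A) ∧ (LinearMap.toMatrix v v As).IsDiag) ∧
  (∃ v : Module.Basis (Fin (d + 1)) F V,
    IsIrreducibleTridiagonal (LinearMap.toMatrix v v As) ∧ (LinearMap.toMatrix v v A).IsDiag)

/-- The tridiagonal matrix with diagonal `x 0, …, x d`, superdiagonal `y 1, …, y d`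
and subdiagonal `z 1, …, z d`; the entry `y i` is in row `i - 1` and column `i`, the entry `z i`
is in row `i` and column `i - 1`. -/
def tridiagonalMatrix {F : Type*} [Field F] (d : ℕ) (x y z : ℕ → F) :
    Matrix (Fin (d + 1)) (Fin (d + 1)) F :=
  Matrix.of fun i j =>
    if (i : ℕ) = j then x i
    else if (i : ℕ) + 1 = j then y j
    else if (i : ℕ) = j + 1 then z i
    else 0

/-- The lower bidiagonal matrix with diagonal `θ 0, …, θ d` and subdiagonal entries all `1`. -/
def lowerBidiagonalMatrix {F : Type*} [Field F] (d : ℕ) (θ : ℕ → F) :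
    Matrix (Fin (d + 1)) (Fin (d + 1)) F :=
  tridiagonalMatrix d θ (fun _ => 0) (fun _ => 1)

/-- The upper bidiagonal matrix with diagonal `θ 0, …, θ d` and superdiagonal `φ 1, …, φ d`. -/
def upperBidiagonalMatrix {F : Type*} [Field F] (d : ℕ) (θ φ : ℕ → F) :
    Matrix (Fin (d + 1)) (Fin (d + 1)) F :=
  tridiagonalMatrix d θ φ (fun _ => 0)

/-- An ordered pair of matrices `A, As` is LB-TD: `A` is lower bidiagonal with subdiagonal entries
all `1`, and `As` is irreducible tridiagonal. -/
def IsLBTD {F : Type*} [Field F] {d : ℕ} (A As : Matrix (Fin (d + 1)) (Fin (d + 1)) F) : Prop :=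
  ((∀ i j : Fin (d + 1), (i : ℕ) ≠ j → (i : ℕ) ≠ j + 1 → A i j = 0) ∧
    (∀ i j : Fin (d + 1), (i : ℕ) = j + 1 → A i j = 1)) ∧
  IsIrreducibleTridiagonal As

/-- The matrices `A, As` form an LB-TD Leonard pair: they form an LB-TD pair and act on column
vectors as a Leonard pair. -/
def IsLBTDLeonardPair {F : Type*} [Field F] {d : ℕ}
    (A As : Matrix (Fin (d + 1)) (Fin (d + 1)) F) : Prop :=
  IsLBTD A As ∧ IsLeonardPair d (Matrix.toLin' A) (Matrix.toLin' As)

/-- For a Leonard pair formed by `A` and `B` (in either order), `θ 0, …, θ d` is a standard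
ordering of the eigenvalues of `A`: these are distinct, and there is a basis of eigenvectors
`v i` of `A`, with `v i` belonging to `θ i`, with respect to which the matrix representing `B` is
irreducible tridiagonal. -/
def IsStandardOrdering {F V : Type*} [Field F] [AddCommGroup V] [Module F V] (d : ℕ)
    (A B : Module.End F V) (θ : ℕ → F) : Prop :=
  (∀ i j : ℕ, i ≤ d → j ≤ d → θ i = θ j → i = j) ∧
  ∃ v : Module.Basis (Fin (d + 1)) F V,
    (∀ i : Fin (d + 1), A.HasEigenvector (θ i) (v i)) ∧
    IsIrreducibleTridiagonal (LinearMap.toMatrix v v B)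

/-- `φ 1, …, φ d` is the first split sequence of `A, As` associated with the ordering
`(θ, θs)` of their eigenvalues. -/
def IsFirstSplitSequence {F V : Type*} [Field F] [AddCommGroup V] [Module F V] (d : ℕ)
    (A As : Module.End F V) (θ θs φ : ℕ → F) : Prop :=
  ∃ u : Module.Basis (Fin (d + 1)) F V,
    LinearMap.toMatrix u u A = lowerBidiagonalMatrix d θ ∧
    LinearMap.toMatrix u u As = upperBidiagonalMatrix d θs φ

/-- `φ 1, …, φ d` is the second split sequence of `A, As` associated with the ordering `(θ, θs)`:
the first split sequence for `θ` reversed. -/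
def IsSecondSplitSequence {F V : Type*} [Field F] [AddCommGroup V] [Module F V] (d : ℕ)
    (A As : Module.End F V) (θ θs φ : ℕ → F) : Prop :=
  IsFirstSplitSequence d A As (fun i => θ (d - i)) θs φ

/-- `(θ, θs, φ, ϕ)`, with `θ` and `θs` indexed by `0, …, d` and `φ` and `ϕ` by `1, …, d`,
is a parameter array of the Leonard pair `A, As`. (Values at other indices play no role.) -/
def IsParameterArray {F V : Type*} [Field F] [AddCommGroup V] [Module F V] (d : ℕ)
    (A As : Module.End F V) (θ θs φ ϕ : ℕ → F) : Prop :=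
  IsStandardOrdering d A As θ ∧ IsStandardOrdering d As A θs ∧
  IsFirstSplitSequence d A As θ θs φ ∧ IsSecondSplitSequence d A As θ θs ϕ

/-! An explicit lower triangular matrix T, with entries `splitEntry`, commutes with A and satisfies
A* T = T B, where B is upper bidiagonal with diagonal θ* and superdiagonal φ. Once T is invertible,
its columns form a split basis. Invertibility comes from a Schur-type argument
(`DiagonalizesPair.isUnit_of_intertwines`): a Leonard pair acts irreducibly, so a nonzero
intertwiner is invertible.

Exchanging b and b' leaves A and A* unchanged, reverses θ*, and turns φ_i into ϕ_{d+1-i}. A Leonard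
pair also admits an invertible S with S A = Aᵀ S and S A* = A*ᵀ S
(`DiagonalizesPair.exists_symmetrizer`); transposing by S and reversing the basis converts the
exchanged split form into the one for reversed θ and original θ*, with sequence ϕ.

Standardness also rests on S: in an eigenbasis of one map the other is upper Hessenberg with nonzero
subdiagonal, and S becomes diagonal there, which forces the Hessenberg matrix to be irreducible
tridiagonal. -/

/-! ### Products with tridiagonal matrices. -/

theorem tridiagonalMatrix_transpose {F : Type*} [Field F] (d : ℕ) (x y z : ℕ → F) :
    (tridiagonalMatrix d x y z).transpose = tridiagonalMatrix d x z y := by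
  ext i j
  simp only [Matrix.transpose_apply, tridiagonalMatrix, Matrix.of_apply]
  split_ifs <;> first | rfl | (exfalso; omega) | congr 1

theorem tridiagonalMatrix_mul_apply {F : Type*} [Field F] (d : ℕ) (x y z : ℕ → F) (T : ℕ → ℕ → F)
    (j i : Fin (d + 1)) :
    (tridiagonalMatrix d x y z * Matrix.of fun j i : Fin (d + 1) => T j i) j i =
      x j * T j i + (if (j : ℕ) < d then y (j + 1) * T (j + 1) i else 0)
        + (if 0 < (j : ℕ) then z j * T (j - 1) i else 0) := by
  obtain ⟨j, hj⟩ := j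
  simp only [Matrix.mul_apply, tridiagonalMatrix, Matrix.of_apply]
  rw [Fin.sum_univ_eq_sum_range (fun k => (if j = k then x j else if j + 1 = k then y k
    else if j = k + 1 then z j else 0) * T k i) (d + 1)]
  have key : ∀ k ∈ Finset.range (d + 1), (if j = k then x j else if j + 1 = k then y k
      else if j = k + 1 then z j else 0) * T k i =
      (if j = k then x j * T j i else 0) + (if j + 1 = k then y (j + 1) * T (j + 1) i else 0)
        + (if j - 1 = k then (if 0 < j then z j * T (j - 1) i else 0) else 0) := by
    intro k _
    split_ifs <;> first | (exfalso; omega) | (subst_vars; simp)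
  rw [Finset.sum_congr rfl key, Finset.sum_add_distrib, Finset.sum_add_distrib,
    Finset.sum_ite_eq, Finset.sum_ite_eq, Finset.sum_ite_eq]
  have h1 : j ∈ Finset.range (d + 1) := Finset.mem_range.2 hj
  have h2 : j - 1 ∈ Finset.range (d + 1) := Finset.mem_range.2 (by omega)
  simp only [h1, h2, if_true, Finset.mem_range, Nat.add_lt_add_iff_right]

theorem mul_tridiagonalMatrix_apply {F : Type*} [Field F] (d : ℕ) (x y z : ℕ → F) (T : ℕ → ℕ → F)
    (j i : Fin (d + 1)) :
    ((Matrix.of fun j i : Fin (d + 1) => T j i) * tridiagonalMatrix d x y z) j i =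
      T j i * x i + (if (i : ℕ) < d then T j (i + 1) * z (i + 1) else 0)
        + (if 0 < (i : ℕ) then T j (i - 1) * y i else 0) := by
  rw [← Matrix.transpose_apply (_ * _), Matrix.transpose_mul, tridiagonalMatrix_transpose]
  have := tridiagonalMatrix_mul_apply d x z y (fun j i => T i j) i j
  simp only [mul_comm] at this ⊢
  exact this

/-! ### The explicit transition matrix and its recurrences. -/

/-- The entries, up to normalization, of the transition matrix to the split basis. -/
def splitEntry {F : Type*} [Field F] (d : ℕ) (q a a' b' c : F) (j i : ℕ) : F :=
  (∏ k ∈ Finset.range j, -c * q ^ (-(k : ℤ)) *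
      ((q ^ ((k : ℤ) + 1) - q ^ (-(k : ℤ) - 1)) * (b' - a' * c * q ^ ((d : ℤ) - 2 * k - 1)))⁻¹) *
    ∏ k ∈ Finset.range i, -(q ^ ((j : ℤ) - k) - q ^ ((k : ℤ) - j)) * q ^ ((j : ℤ) - k - 1) * c⁻¹ *
      (b' - a * c * q ^ (2 * (k : ℤ) + 1 - d))

section
variable {F : Type*} [Field F] (d : ℕ) (q a a' b' c : F)

theorem splitEntry_zero_zero : splitEntry d q a a' b' c 0 0 = 1 := by simp [splitEntry]

theorem splitEntry_succ_right (j i : ℕ) :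
    splitEntry d q a a' b' c j (i + 1) = splitEntry d q a a' b' c j i *
      (-(q ^ ((j : ℤ) - i) - q ^ ((i : ℤ) - j)) * q ^ ((j : ℤ) - i - 1) * c⁻¹ *
        (b' - a * c * q ^ (2 * (i : ℤ) + 1 - d))) := by
  rw [splitEntry, splitEntry, Finset.prod_range_succ]; ring

theorem splitEntry_eq_zero {j i : ℕ} (h : j < i) : splitEntry d q a a' b' c j i = 0 := by
  rw [splitEntry, Finset.prod_eq_zero (i := j) (s := Finset.range i) (Finset.mem_range.2 h), mul_zero]
  simp

variable {q c}

theorem zpow_sub_zpow_neg_ne_zero (hq0 : q ≠ 0) (hq : ∀ n : ℕ, 0 < n → q ^ n ≠ 1) (n : ℕ)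
    (hn : 0 < n) : q ^ (n : ℤ) - q ^ (-(n : ℤ)) ≠ 0 := by
  intro h
  apply hq (n + n) (by omega)
  have h2 : q ^ (n : ℤ) = q ^ (-(n : ℤ)) := sub_eq_zero.1 h
  rw [pow_add]
  rw [zpow_neg, zpow_natCast] at h2
  nth_rewrite 1 [h2]
  exact inv_mul_cancel₀ (pow_ne_zero _ hq0)

/-- The ratio of vertical neighbours, with the denominator cleared because the q-bracket vanishes at
i = j + 1. Induction on i works because the factors gained by columns in rows j and j + 1 differ
only in brackets and a power of q. -/
theorem splitEntry_succ_left (hq0 : q ≠ 0) (hq : ∀ n : ℕ, 0 < n → q ^ n ≠ 1) (j i : ℕ)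
    (hB : b' - a' * c * q ^ ((d : ℤ) - 2 * j - 1) ≠ 0) :
    splitEntry d q a a' b' c (j + 1) i * ((q ^ ((j : ℤ) + 1 - i) - q ^ ((i : ℤ) - j - 1)) *
      (b' - a' * c * q ^ ((d : ℤ) - 2 * j - 1))) =
    -c * q ^ ((i : ℤ) - j) * splitEntry d q a a' b' c j i := by
  induction i with
  | zero =>
    have h := zpow_sub_zpow_neg_ne_zero hq0 hq (j + 1) (by omega)
    have e : -((j + 1 : ℕ) : ℤ) = -(j : ℤ) - 1 := by push_cast; ring
    rw [e] at h
    push_cast at h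
    simp only [splitEntry, Finset.prod_range_succ, Finset.prod_range_zero, Nat.cast_zero, mul_one,
      sub_zero, zero_sub]
    rw [mul_assoc, mul_assoc (-c * _), inv_mul_cancel₀ (mul_ne_zero h hB), mul_one, mul_comm]
  | succ i ih =>
    rw [splitEntry_succ_right, splitEntry_succ_right]
    have e1 : ((j + 1 : ℕ) : ℤ) - i - 1 = (j : ℤ) - i - 1 + 1 := by push_cast; ring
    have e2 : ((i + 1 : ℕ) : ℤ) - j = (i : ℤ) - j + 1 := by push_cast; ring
    have e3 : ((j + 1 : ℕ) : ℤ) - i = (j : ℤ) + 1 - i := by push_cast; ring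
    have e4 : (i : ℤ) - ((j + 1 : ℕ) : ℤ) = (i : ℤ) - j - 1 := by push_cast; ring
    have e5 : (j : ℤ) + 1 - ((i + 1 : ℕ) : ℤ) = (j : ℤ) - i := by push_cast; ring
    have e6 : ((i + 1 : ℕ) : ℤ) - j - 1 = (i : ℤ) - j := by push_cast; ring
    rw [e1, e6, e2, e3, e4, e5, zpow_add_one₀ hq0, zpow_add_one₀ hq0]
    linear_combination (-(q ^ ((j : ℤ) - i) - q ^ ((i : ℤ) - j)) * (q ^ ((j : ℤ) - i - 1) * q) *
      c⁻¹ * (b' - a * c * q ^ (2 * (i : ℤ) + 1 - d))) * ih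
end

/-! ### Intertwining relations for the transition matrix. -/

section
variable {F : Type*} [Field F] {d : ℕ} {q c α αs a a' b b' : F} {θ x y z θs φ : ℕ → F}

/-- Writing T for the matrix, the claim is T_{j-1,i} = (θ_i - θ_j) T_{j,i} + T_{j,i+1}. Both
neighbours are multiples of T_{j,i}, leaving a rational identity in q^i, q^j, q^d. -/
theorem lowerBidiagonal_mul_splitEntry (hq0 : q ≠ 0) (hq : ∀ n : ℕ, 0 < n → q ^ n ≠ 1) (hc : c ≠ 0)
    (hθ : ∀ i : ℕ, i ≤ d →
      θ i = α + a * q ^ (2 * (i : ℤ) - d) + a' * q ^ ((d : ℤ) - 2 * i))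
    (hB : ∀ i : ℕ, i < d → b' - a' * c * q ^ ((d : ℤ) - 2 * i - 1) ≠ 0) :
    lowerBidiagonalMatrix d θ * Matrix.of (fun j i : Fin (d + 1) => splitEntry d q a a' b' c j i) =
      Matrix.of (fun j i : Fin (d + 1) => splitEntry d q a a' b' c j i) *
        lowerBidiagonalMatrix d θ := by
  ext j i
  rw [lowerBidiagonalMatrix, tridiagonalMatrix_mul_apply, mul_tridiagonalMatrix_apply]
  obtain ⟨j, hj⟩ := j
  obtain ⟨i, hi⟩ := i
  -- For i = d the entry lies in column d + 1, beyond row j ≤ d, so it is already zero.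
  have e : (if i < d then splitEntry d q a a' b' c j (i + 1) * 1 else 0) =
      splitEntry d q a a' b' c j (i + 1) := by
    split_ifs
    · rw [mul_one]
    · rw [splitEntry_eq_zero]; omega
  simp only [zero_mul, mul_zero, ite_self, add_zero, one_mul, e]
  rw [splitEntry_succ_right, hθ i (by omega), hθ j (by omega)]
  cases j with
  | zero =>
    rcases i.eq_zero_or_pos with rfl | hi0
    · simp; ring
    · rw [splitEntry_eq_zero _ _ _ _ _ _ hi0]; simp
  | succ j =>
    have h := splitEntry_succ_left d a a' b' hq0 hq j i (hB j (by omega))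
    have hr : splitEntry d q a a' b' c j i = -c⁻¹ * q ^ ((j : ℤ) - i) *
        (splitEntry d q a a' b' c (j + 1) i * ((q ^ ((j : ℤ) + 1 - i) - q ^ ((i : ℤ) - j - 1)) *
          (b' - a' * c * q ^ ((d : ℤ) - 2 * j - 1)))) := by
      rw [h]
      have h1 : q ^ ((j : ℤ) - i) * q ^ ((i : ℤ) - j) = 1 := by
        rw [← zpow_add₀ hq0]; simp
      have h2 : c⁻¹ * c = 1 := inv_mul_cancel₀ hc
      linear_combination (-splitEntry d q a a' b' c j i) * c⁻¹ * c * h1 -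
        splitEntry d q a a' b' c j i * h2
    simp only [Nat.succ_pos, if_true, Nat.add_sub_cancel, hr]
    generalize splitEntry d q a a' b' c (j + 1) i = t
    have hP : q ^ j ≠ 0 := pow_ne_zero _ hq0
    have hQ : q ^ i ≠ 0 := pow_ne_zero _ hq0
    have hD : q ^ d ≠ 0 := pow_ne_zero _ hq0
    push_cast
    simp only [zpow_add₀ hq0, zpow_sub₀ hq0, two_mul, zpow_one, zpow_natCast]
    generalize q ^ j = P at *
    generalize q ^ i = Q at *
    generalize q ^ d = D at *
    field_simp
    ring

/-- Triangularity makes both sides zero for i > j + 1 and leaves y_{j+1} T_{j+1,j+1} = T_{j,j}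
φ_{j+1} for i = j + 1. For i ≤ j every term, once multiplied by one q-bracket, is a multiple of
T_{j,i}. -/
theorem tridiagonal_mul_splitEntry (hq0 : q ≠ 0) (hq : ∀ n : ℕ, 0 < n → q ^ n ≠ 1) (hc : c ≠ 0)
    (hx : ∀ i : ℕ, i ≤ d →
      x i = αs + (b + b') * q ^ ((d : ℤ) - 2 * i)
        + a' * c * q ^ ((d : ℤ) - 2 * i)
          * (q ^ ((d : ℤ) + 1) + q ^ (-(d : ℤ) - 1)
            - q ^ ((d : ℤ) - 2 * i - 1) - q ^ ((d : ℤ) - 2 * i + 1)))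
    (hy : ∀ i : ℕ, 1 ≤ i → i ≤ d →
      y i = (q ^ (i : ℤ) - q ^ (-(i : ℤ))) * (q ^ ((d : ℤ) - i + 1) - q ^ ((i : ℤ) - d - 1))
        * (b - a' * c * q ^ ((d : ℤ) - 2 * i + 1))
        * (b' - a' * c * q ^ ((d : ℤ) - 2 * i + 1)) * c⁻¹)
    (hz : ∀ i : ℕ, 1 ≤ i → i ≤ d →
      z i = -c * q ^ ((d : ℤ) - 2 * i + 1))
    (hθs : ∀ i : ℕ, i ≤ d →
      θs i = αs + b * q ^ (2 * (i : ℤ) - d) + b' * q ^ ((d : ℤ) - 2 * i))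
    (hφ : ∀ i : ℕ, 1 ≤ i → i ≤ d →
      φ i = (q ^ (i : ℤ) - q ^ (-(i : ℤ))) * (q ^ ((d : ℤ) - i + 1) - q ^ ((i : ℤ) - d - 1))
        * (b - a' * c * q ^ ((d : ℤ) - 2 * i + 1))
        * (b' - a * c * q ^ (2 * (i : ℤ) - d - 1)) * c⁻¹)
    (hB : ∀ i : ℕ, i < d → b' - a' * c * q ^ ((d : ℤ) - 2 * i - 1) ≠ 0) :
    tridiagonalMatrix d x y z *
        Matrix.of (fun j i : Fin (d + 1) => splitEntry d q a a' b' c j i) =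
      Matrix.of (fun j i : Fin (d + 1) => splitEntry d q a a' b' c j i) *
        upperBidiagonalMatrix d θs φ := by
  have hP : ∀ k : ℕ, q ^ k ≠ 0 := fun k => pow_ne_zero _ hq0
  have hD : q ^ d ≠ 0 := pow_ne_zero _ hq0
  ext j i
  rw [upperBidiagonalMatrix, tridiagonalMatrix_mul_apply, mul_tridiagonalMatrix_apply]
  obtain ⟨j, hj⟩ := j
  obtain ⟨i, hi⟩ := i
  simp only [mul_zero, ite_self, add_zero]
  rcases lt_trichotomy (j + 1) i with hji | rfl | hji
  · rw [splitEntry_eq_zero (i := i) (j := j), splitEntry_eq_zero (i := i) (j := j + 1),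
      splitEntry_eq_zero (i := i) (j := j - 1), splitEntry_eq_zero (i := i - 1) (j := j)]
    · simp
    all_goals omega
  · rw [splitEntry_eq_zero (i := j + 1) (j := j), splitEntry_eq_zero (i := j + 1) (j := j - 1)]
    · have h := splitEntry_succ_left d a a' b' hq0 hq j j (hB j (by omega))
      have hr := splitEntry_succ_right d q a a' b' c (j + 1) j
      rw [if_pos (by omega : j < d), if_pos (by omega : 0 < j + 1), hy _ (by omega) (by omega),
        hφ _ (by omega) (by omega), hr, Nat.add_sub_cancel]
      have e1 : (d : ℤ) - 2 * (j + 1 : ℕ) + 1 = (d : ℤ) - 2 * j - 1 := by push_cast; ring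
      rw [e1]
      have hB' := hB j (by omega)
      generalize b' - a' * c * q ^ ((d : ℤ) - 2 * j - 1) = B at *
      have e2 : (j : ℤ) + 1 - j = 1 := by ring
      have e3 : (j : ℤ) - j - 1 = -1 := by ring
      have e4 : ((j + 1 : ℕ) : ℤ) - j = 1 := by push_cast; ring
      have e5 : (j : ℤ) - ((j + 1 : ℕ) : ℤ) = -1 := by push_cast; ring
      have e6 : 2 * ((j + 1 : ℕ) : ℤ) - d - 1 = 2 * (j : ℤ) + 1 - d := by push_cast; ring
      rw [e2, e3, sub_self, zpow_zero, mul_one] at h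
      rw [e4, e5, e6, sub_self, zpow_zero, mul_one]
      have hcc : c⁻¹ * c = 1 := inv_mul_cancel₀ hc
      simp only [mul_zero, zero_add, zero_mul, ite_self, add_zero]
      generalize splitEntry d q a a' b' c (j + 1) j = t at *
      generalize splitEntry d q a a' b' c j j = s at *
      generalize q ^ (1 : ℤ) - q ^ (-1 : ℤ) = o at *
      generalize (q ^ ((j + 1 : ℕ) : ℤ) - q ^ (-((j + 1 : ℕ) : ℤ))) *
        (q ^ ((d : ℤ) - ((j + 1 : ℕ) : ℤ) + 1) - q ^ (((j + 1 : ℕ) : ℤ) - d - 1)) = e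
      generalize b - a' * c * q ^ ((d : ℤ) - 2 * j - 1) = f
      generalize b' - a * c * q ^ (2 * (j : ℤ) + 1 - d) = g
      linear_combination (-e * f * g * c⁻¹ * c⁻¹) * h + e * f * g * c⁻¹ * s * hcc
    all_goals omega
  -- This bracket is nonzero since i ≤ j and q is not a root of unity; it clears denominators and is
  -- cancelled at the end.
  · have hn := zpow_sub_zpow_neg_ne_zero hq0 hq (j + 1 - i) (by omega)
    rw [Nat.cast_sub (by omega)] at hn
    push_cast at hn
    rw [neg_sub, ← sub_sub] at hn
    -- each of the remaining terms is a multiple of the entry at `(j, i)`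
    have h1 : (q ^ ((j : ℤ) + 1 - i) - q ^ ((i : ℤ) - j - 1)) *
        (if j < d then y (j + 1) * splitEntry d q a a' b' c (j + 1) i else 0) =
        -q ^ ((i : ℤ) - j) * (q ^ ((j : ℤ) + 1) - q ^ (-(j : ℤ) - 1)) *
          (q ^ ((d : ℤ) - j) - q ^ ((j : ℤ) - d)) * (b - a' * c * q ^ ((d : ℤ) - 2 * j - 1)) *
          splitEntry d q a a' b' c j i := by
      split_ifs with hjd
      · have h := splitEntry_succ_left d a a' b' hq0 hq j i (hB j (by omega))
        rw [hy _ (by omega) (by omega)]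
        have e1 : (d : ℤ) - 2 * (j + 1 : ℕ) + 1 = (d : ℤ) - 2 * j - 1 := by push_cast; ring
        have e2 : (d : ℤ) - (j + 1 : ℕ) + 1 = (d : ℤ) - j := by push_cast; ring
        have e3 : ((j + 1 : ℕ) : ℤ) - d - 1 = (j : ℤ) - d := by push_cast; ring
        have e4 : -((j + 1 : ℕ) : ℤ) = -(j : ℤ) - 1 := by push_cast; ring
        rw [e1, e2, e3, e4]
        push_cast
        have hcc : c⁻¹ * c = 1 := inv_mul_cancel₀ hc
        linear_combination ((q ^ ((j : ℤ) + 1) - q ^ (-(j : ℤ) - 1)) *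
          (q ^ ((d : ℤ) - j) - q ^ ((j : ℤ) - d)) * (b - a' * c * q ^ ((d : ℤ) - 2 * j - 1)) * c⁻¹)
          * h - (q ^ ((i : ℤ) - j) * (q ^ ((j : ℤ) + 1) - q ^ (-(j : ℤ) - 1)) *
          (q ^ ((d : ℤ) - j) - q ^ ((j : ℤ) - d)) * (b - a' * c * q ^ ((d : ℤ) - 2 * j - 1)) *
          splitEntry d q a a' b' c j i) * hcc
      -- In the last row the factor q^(d-j) - q^(j-d) vanishes, so the same formula covers the
      -- boundary.
      · obtain rfl : j = d := by omega
        simp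
    have h2 : (if 0 < j then z j * splitEntry d q a a' b' c (j - 1) i else 0) =
        q ^ ((d : ℤ) - j - i) * (q ^ ((j : ℤ) - i) - q ^ ((i : ℤ) - j)) *
          (b' - a' * c * q ^ ((d : ℤ) - 2 * j + 1)) * splitEntry d q a a' b' c j i := by
      cases j with
      | zero =>
        obtain rfl : i = 0 := by omega
        simp
      | succ j =>
        have h := splitEntry_succ_left d a a' b' hq0 hq j i (hB j (by omega))
        rw [if_pos (by omega), Nat.add_sub_cancel, hz _ (by omega) (by omega)]
        have e1 : (d : ℤ) - 2 * (j + 1 : ℕ) + 1 = (d : ℤ) - 2 * j - 1 := by push_cast; ring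
        have e2 : (d : ℤ) - (j + 1 : ℕ) - i = (d : ℤ) - 2 * j - 1 - (i - j) := by push_cast; ring
        have e3 : ((j + 1 : ℕ) : ℤ) - i = (j : ℤ) + 1 - i := by push_cast; ring
        have e4 : (i : ℤ) - (j + 1 : ℕ) = (i : ℤ) - j - 1 := by push_cast; ring
        rw [e1, e2, e3, e4]
        have e5 : q ^ ((d : ℤ) - 2 * j - 1 - (i - j)) * q ^ ((i : ℤ) - j) =
            q ^ ((d : ℤ) - 2 * j - 1) := by rw [← zpow_add₀ hq0]; congr 1; ring
        linear_combination (-q ^ ((d : ℤ) - 2 * j - 1 - (i - j))) * h +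
          c * splitEntry d q a a' b' c j i * e5
    have h3 : (q ^ ((j : ℤ) + 1 - i) - q ^ ((i : ℤ) - j - 1)) *
        (if 0 < i then splitEntry d q a a' b' c j (i - 1) * φ i else 0) =
        -q ^ ((i : ℤ) - j) * (q ^ (i : ℤ) - q ^ (-(i : ℤ))) *
          (q ^ ((d : ℤ) - i + 1) - q ^ ((i : ℤ) - d - 1)) *
          (b - a' * c * q ^ ((d : ℤ) - 2 * i + 1)) * splitEntry d q a a' b' c j i := by
      cases i with
      | zero => simp
      | succ i =>
        rw [if_pos (by omega), Nat.add_sub_cancel, splitEntry_succ_right,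
          hφ _ (by omega) (by omega)]
        have e1 : (j : ℤ) + 1 - (i + 1 : ℕ) = (j : ℤ) - i := by push_cast; ring
        have e2 : ((i + 1 : ℕ) : ℤ) - j - 1 = (i : ℤ) - j := by push_cast; ring
        have e3 : ((i + 1 : ℕ) : ℤ) - j = (i : ℤ) + 1 - j := by push_cast; ring
        have e4 : 2 * ((i + 1 : ℕ) : ℤ) - d - 1 = 2 * (i : ℤ) + 1 - d := by push_cast; ring
        have e5 : q ^ ((i : ℤ) + 1 - j) * q ^ ((j : ℤ) - i - 1) = 1 := by
          rw [← zpow_add₀ hq0, ← zpow_zero q]; congr 1; ring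
        rw [e1, e2, e3, e4]
        linear_combination (-(q ^ ((j : ℤ) - i) - q ^ ((i : ℤ) - j)) *
          splitEntry d q a a' b' c j i * (q ^ ((i + 1 : ℕ) : ℤ) - q ^ (-((i + 1 : ℕ) : ℤ))) *
          (q ^ ((d : ℤ) - (i + 1 : ℕ) + 1) - q ^ (((i + 1 : ℕ) : ℤ) - d - 1)) *
          (b - a' * c * q ^ ((d : ℤ) - 2 * (i + 1 : ℕ) + 1)) *
          (b' - a * c * q ^ (2 * (i : ℤ) + 1 - d)) * c⁻¹) * e5
    apply mul_left_cancel₀ hn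
    rw [mul_add, mul_add, mul_add, h1, h2, h3, hx j (by omega), hθs i (by omega)]
    generalize splitEntry d q a a' b' c j i = t
    have hPj := hP j
    have hPi := hP i
    clear h1 h2 h3 hn hP hB
    simp only [zpow_add₀ hq0, zpow_sub₀ hq0, zpow_neg, two_mul, zpow_one, zpow_natCast]
    generalize q ^ j = P at *
    generalize q ^ i = Q at *
    generalize q ^ d = D at *
    field_simp
    ring
end

/-! ### Leonard pairs in matrix form: simple spectrum, irreducibility, symmetrizer. -/

open Matrix

section
variable {F : Type*} [Field F]

theorem Matrix.charpoly_eq_of_mul_eq_mul {n : Type*} [Fintype n] [DecidableEq n]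
    {X M : Matrix n n F} (P : (Matrix n n F)ˣ) (h : X * P = P * M) : X.charpoly = M.charpoly := by
  have hX : X = P.val * M * P⁻¹.val := by rw [← h, Units.mul_inv_cancel_right]
  rw [hX, ← charpoly_units_conj P M, coe_units_inv]

theorem Function.Injective.of_prod_X_sub_C_eq {n : Type*} [Fintype n] {f g : n → F}
    (hg : Function.Injective g)
    (h : ∏ i, (Polynomial.X - Polynomial.C (f i)) = ∏ i, (Polynomial.X - Polynomial.C (g i))) :
    Function.Injective f := by
  have h' := congrArg Polynomial.roots h
  have key : ∀ f : n → F, (∏ i, (Polynomial.X - Polynomial.C (f i))).roots =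
      (Finset.univ : Finset n).val.map f := fun f => by
    rw [← Polynomial.roots_multiset_prod_X_sub_C (Finset.univ.val.map f), Multiset.map_map]
    rfl
  rw [key, key] at h'
  have hn : ((Finset.univ : Finset n).val.map f).Nodup := by
    rw [h']
    exact Multiset.Nodup.map hg Finset.univ.nodup
  intro i j hij
  exact Multiset.inj_on_of_nodup_map hn i (Finset.mem_univ i) j (Finset.mem_univ j) hij

theorem exists_units_mul_toMatrix {n : Type*} [Fintype n] [DecidableEq n]
    (v : Module.Basis n F (n → F)) :
    ∃ P : (Matrix n n F)ˣ, ∀ X : Matrix n n F,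
      X * P = P * LinearMap.toMatrix v v (toLin' X) := by
  let e := Pi.basisFun F n
  refine ⟨⟨e.toMatrix v, v.toMatrix e, e.toMatrix_mul_toMatrix_flip v,
    v.toMatrix_mul_toMatrix_flip e⟩, fun X => ?_⟩
  change X * e.toMatrix v = e.toMatrix v * _
  rw [basis_toMatrix_mul_linearMap_toMatrix]
  have : X = LinearMap.toMatrix e e (toLin' X) := by
    rw [LinearMap.toMatrix_eq_toMatrix', LinearMap.toMatrix'_toLin']
  conv_lhs => rw [this]
  rw [linearMap_toMatrix_mul_basis_toMatrix]

theorem exists_basis_toMatrix_toLin' {n : Type*} [Fintype n] [DecidableEq n]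
    (P : (Matrix n n F)ˣ) :
    ∃ v : Module.Basis n F (n → F), (∀ i, v i = P.val.col i) ∧ ∀ X M : Matrix n n F, X * P = P * M →
      LinearMap.toMatrix v v (toLin' X) = M := by
  let e := Pi.basisFun F n
  let v := e.map (P.val.toLinearEquiv' P.invertible)
  have hv : ∀ i, v i = P.val.col i := by
    intro i
    have : v i = (P.val.toLinearEquiv' P.invertible : Module.End F (n → F)) (Pi.single i 1) := by
      rw [← Pi.basisFun_apply]
      exact Module.Basis.map_apply _ _ _
    rw [this, toLinearEquiv'_apply, toLin'_apply, mulVec_single_one]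
  refine ⟨v, hv, fun X M h => ?_⟩
  have hP : e.toMatrix v = P.val := by
    ext i j
    rw [Module.Basis.toMatrix_apply, hv]
    simp [e]
  have h1 : X * e.toMatrix v = e.toMatrix v * LinearMap.toMatrix v v (toLin' X) := by
    rw [basis_toMatrix_mul_linearMap_toMatrix]
    have : X = LinearMap.toMatrix e e (toLin' X) := by
      rw [LinearMap.toMatrix_eq_toMatrix', LinearMap.toMatrix'_toLin']
    conv_lhs => rw [this]
    rw [linearMap_toMatrix_mul_basis_toMatrix]
  rw [hP, h] at h1
  exact (P.isUnit.mul_left_cancel h1).symm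

variable {d : ℕ}

/-- The eigenvector equation is a three-term recurrence with nonzero superdiagonal coefficients, so
the initial coordinate determines all others. -/
theorem eq_zero_of_mulVec_eq_smul {M : Matrix (Fin (d + 1)) (Fin (d + 1)) F}
    (hM : IsIrreducibleTridiagonal M) {l : F} {v : Fin (d + 1) → F} (hv : M *ᵥ v = l • v)
    (h0 : v 0 = 0) : v = 0 := by
  have key : ∀ n : ℕ, ∀ i : Fin (d + 1), (i : ℕ) ≤ n → v i = 0 := by
    intro n
    induction n with
    | zero =>
      intro i hi
      rw [show i = 0 from Fin.ext (by simpa using hi), h0]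
    | succ n ih =>
      intro i hi
      rcases Nat.lt_or_ge i (n + 1) with h | h
      · exact ih i (by omega)
      have hin : (i : ℕ) = n + 1 := by omega
      let k : Fin (d + 1) := ⟨n, by omega⟩
      have hk : (k : ℕ) = n := rfl
      have h1 := congrFun hv k
      rw [Pi.smul_apply, ih k le_rfl, smul_zero, mulVec, dotProduct,
        Finset.sum_eq_single i] at h1
      · exact (mul_eq_zero.1 h1).resolve_left (hM.2 k i (Or.inr (by omega)))
      · intro j _ hj
        rcases Nat.lt_or_ge n j with h2 | h2
        · rw [hM.1 k j, zero_mul]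
          all_goals have := fun h => hj (Fin.ext h); omega
        · rw [ih j h2, mul_zero]
      · simp
  exact funext fun i => key i i le_rfl

/-- Eigenspaces of M are at most one-dimensional, while a repeated diagonal entry would give two
independent eigenvectors. -/
theorem injective_of_mul_diagonal {M : Matrix (Fin (d + 1)) (Fin (d + 1)) F}
    (hM : IsIrreducibleTridiagonal M) {D : Fin (d + 1) → F}
    (P : (Matrix (Fin (d + 1)) (Fin (d + 1)) F)ˣ) (h : M * P = P * diagonal D) :
    Function.Injective D := by
  intro i j hij
  by_contra hne
  have hcol : ∀ w : Fin (d + 1) → F, diagonal D *ᵥ w = D i • w → (P.val *ᵥ w) 0 = 0 → w = 0 := by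
    intro w hw h0
    have : P.val *ᵥ w = 0 := by
      refine eq_zero_of_mulVec_eq_smul hM (l := D i) ?_ h0
      rw [mulVec_mulVec, h, ← mulVec_mulVec, hw, mulVec_smul]
    calc w = (P⁻¹.val * P.val) *ᵥ w := by simp
      _ = 0 := by rw [← mulVec_mulVec, this, mulVec_zero]
  -- The combination is chosen to cancel the initial coordinate of the eigenvector.
  have hw := hcol (P.val 0 j • Pi.single i 1 - P.val 0 i • Pi.single j 1) (by
    ext k
    rw [mulVec_diagonal]
    simp only [Pi.sub_apply, Pi.smul_apply, Pi.single_apply, smul_eq_mul]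
    split_ifs with h1 h2 h2
    · exact absurd (h1.symm.trans h2) hne
    · rw [h1]
    · rw [h2, hij]
    · simp) (by
    simp only [mulVec_sub, mulVec_smul, mulVec_single_one]
    simp [mul_comm])
  have h1 := congrFun hw j
  simp only [Pi.sub_apply, Pi.smul_apply, Pi.single_apply, smul_eq_mul, Ne.symm hne, if_true,
    if_false, Pi.zero_apply, mul_zero, mul_one, zero_sub, neg_eq_zero] at h1
  have h2 := hcol (Pi.single j 1) (by
    ext k
    rw [mulVec_diagonal]
    simp only [Pi.smul_apply, Pi.single_apply, smul_eq_mul]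
    split_ifs with h1
    · rw [h1, hij]
    · simp) (by
    rw [mulVec_single_one]
    have h3 := congrFun hw i
    simp only [Pi.sub_apply, Pi.smul_apply, Pi.single_apply, smul_eq_mul, hne, if_true,
      if_false, Pi.zero_apply, mul_zero, mul_one, sub_zero] at h3
    simpa using h3)
  simpa using congrFun h2 j

/-- The matrix form of a Leonard pair: in the coordinates `P` the matrix `X` is irreducible
tridiagonal, and `Y` is diagonal with distinct entries. -/
structure DiagonalizesPair (X Y : Matrix (Fin (d + 1)) (Fin (d + 1)) F)
    (P : (Matrix (Fin (d + 1)) (Fin (d + 1)) F)ˣ) (M : Matrix (Fin (d + 1)) (Fin (d + 1)) F)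
    (D : Fin (d + 1) → F) : Prop where
  irred : IsIrreducibleTridiagonal M
  injective : Function.Injective D
  left : X * P = P * M
  right : Y * P = P * diagonal D

theorem IsLeonardPair.exists_diagonalizesPair {X Y : Matrix (Fin (d + 1)) (Fin (d + 1)) F}
    (h : IsLeonardPair d (toLin' X) (toLin' Y)) :
    (∃ P M D, DiagonalizesPair X Y P M D) ∧ ∃ P M D, DiagonalizesPair Y X P M D := by
  obtain ⟨⟨v, hv1, hv2⟩, w, hw1, hw2⟩ := h
  obtain ⟨P, hP⟩ := exists_units_mul_toMatrix v
  obtain ⟨Q, hQ⟩ := exists_units_mul_toMatrix w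
  have hXP := hP X
  have hYP := hP Y
  have hXQ := hQ X
  have hYQ := hQ Y
  rw [← hv2.diagonal_diag] at hYP
  rw [← hw2.diagonal_diag] at hXQ
  refine ⟨⟨P, _, _, hv1, injective_of_mul_diagonal hw1 (Q⁻¹ * P) ?_, hXP, hYP⟩,
    ⟨Q, _, _, hw1, injective_of_mul_diagonal hv1 (P⁻¹ * Q) ?_, hYQ, hXQ⟩⟩
  · have : LinearMap.toMatrix w w (toLin' Y) = Q⁻¹.val * Y * Q.val := by
      rw [mul_assoc, hYQ, Units.inv_mul_cancel_left]
    rw [this, Units.val_mul, mul_assoc _ P.val, ← hYP]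
    simp only [mul_assoc, Units.mul_inv_cancel_left]
  · have : LinearMap.toMatrix v v (toLin' X) = P⁻¹.val * X * P.val := by
      rw [mul_assoc, hXP, Units.inv_mul_cancel_left]
    rw [this, Units.val_mul, mul_assoc _ Q.val, ← hXQ]
    simp only [mul_assoc, Units.mul_inv_cancel_left]

/-- A version of Schur's lemma. With T = P Z, a nonzero vector in the left kernel of Z forces some
row of Z to vanish, because the distinct diagonal entries separate coordinates. The relation M Z = Z
X' then spreads the zero row to its neighbours, and so to all of Z. -/
theorem DiagonalizesPair.isUnit_of_intertwines
    {X Y M : Matrix (Fin (d + 1)) (Fin (d + 1)) F} {Pu} {D : Fin (d + 1) → F}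
    (h : DiagonalizesPair X Y Pu M D) {T X' Y' : Matrix (Fin (d + 1)) (Fin (d + 1)) F}
    (hT : T ≠ 0) (hX : X * T = T * X') (hY : Y * T = T * Y') : IsUnit T := by
  obtain ⟨hM, hD, h1, h2⟩ := h
  obtain ⟨Z, hTZ⟩ : ∃ Z, T = Pu.val * Z :=
    ⟨Pu⁻¹.val * T, by rw [Units.mul_inv_cancel_left]⟩
  have hMZ : M * Z = Z * X' := by
    apply Pu.isUnit.mul_left_cancel
    rw [← mul_assoc, ← h1, mul_assoc, ← hTZ, hX, ← mul_assoc, ← hTZ]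
  have hDZ : diagonal D * Z = Z * Y' := by
    apply Pu.isUnit.mul_left_cancel
    rw [← mul_assoc, ← h2, mul_assoc, ← hTZ, hY, ← mul_assoc, ← hTZ]
  have hpow : ∀ n : ℕ, diagonal (D ^ n) * Z = Z * Y' ^ n := by
    intro n
    induction n with
    | zero => simp
    | succ n ih =>
      rw [pow_succ Y', ← mul_assoc, ← ih, mul_assoc, ← hDZ, ← mul_assoc,
        diagonal_mul_diagonal, pow_succ]
      rfl
  have hproj : ∀ y : Fin (d + 1) → F, y ᵥ* Z = 0 → ∀ k, y k ≠ 0 → ∀ j, Z k j = 0 := by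
    intro y hy k hk j
    -- All the power sums ∑ D_i^n (y_i Z_{ij}) vanish, so a Vandermonde argument applies.
    have hv : (fun i => y i * Z i j) = 0 := by
      refine eq_zero_of_forall_pow_sum_mul_pow_eq_zero hD fun n => ?_
      have h3 : y ᵥ* (diagonal (D ^ (n : ℕ)) * Z) = 0 := by
        rw [hpow, ← vecMul_vecMul, hy, zero_vecMul]
      refine Eq.trans ?_ (congrFun h3 j)
      rw [← vecMul_vecMul, vecMul, dotProduct]
      refine Finset.sum_congr rfl fun i _ => ?_
      rw [vecMul_diagonal, Pi.pow_apply]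
      ring
    exact (mul_eq_zero.1 (congrFun hv k)).resolve_left hk
  have hstep : ∀ k l : Fin (d + 1), (∀ j, Z k j = 0) → M k l ≠ 0 → ∀ j, Z l j = 0 := by
    intro k l hk hkl
    refine hproj (M k) ?_ l hkl
    ext j
    calc (M k ᵥ* Z) j = (M * Z) k j := rfl
      _ = ∑ i, Z k i * X' i j := by rw [hMZ, mul_apply]
      _ = 0 := Finset.sum_eq_zero fun i _ => by rw [hk, zero_mul]
  rw [isUnit_iff_isUnit_det, isUnit_iff_ne_zero]
  intro hdet
  obtain ⟨y, hy0, hy⟩ := exists_vecMul_eq_zero_iff.2 hdet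
  have hyZ : (y ᵥ* Pu.val) ᵥ* Z = 0 := by rw [vecMul_vecMul, ← hTZ, hy]
  have hyP : y ᵥ* Pu.val ≠ 0 := by
    intro h0
    apply hy0
    calc y = y ᵥ* (Pu.val * Pu⁻¹.val) := by simp
      _ = 0 := by rw [← vecMul_vecMul, h0, zero_vecMul]
  obtain ⟨k, hk⟩ := Function.ne_iff.1 hyP
  have hk0 := hproj _ hyZ k hk
  have up : ∀ n : ℕ, ∀ l : Fin (d + 1), (l : ℕ) = k + n → ∀ j, Z l j = 0 := by
    intro n
    induction n with
    | zero => intro l hl; rwa [show l = k from Fin.ext hl]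
    | succ n ih =>
      intro l hl
      exact hstep ⟨k + n, by omega⟩ l (ih _ rfl) (hM.2 _ _ (Or.inr (by simp; omega)))
  have down : ∀ n : ℕ, ∀ l : Fin (d + 1), (l : ℕ) + n = k → ∀ j, Z l j = 0 := by
    intro n
    induction n with
    | zero => intro l hl; rwa [show l = k from Fin.ext hl]
    | succ n ih =>
      intro l hl
      exact hstep ⟨l + 1, by omega⟩ l (ih _ (by simp; omega)) (hM.2 _ _ (Or.inl rfl))
  apply hT
  rw [hTZ]
  suffices hZ : Z = 0 by rw [hZ, mul_zero]
  ext l j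
  rcases le_total (k : ℕ) l with h3 | h3
  · exact up (l - k) l (by omega) j
  · exact down (k - l) l (by omega) j

/-- The condition amounts to k_{i+1} / k_i = M_{i,i+1} / M_{i+1,i}, solved by a product of ratios.
-/
theorem IsIrreducibleTridiagonal.exists_symmetrizer {M : Matrix (Fin (d + 1)) (Fin (d + 1)) F}
    (hM : IsIrreducibleTridiagonal M) :
    ∃ k : Fin (d + 1) → F, (∀ i, k i ≠ 0) ∧ diagonal k * M = Mᵀ * diagonal k := by
  -- The default 1 only keeps `r` nonzero everywhere; the products with i ≤ d never reach it.
  let r : ℕ → F := fun l => if h : l + 1 < d + 1 then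
    M ⟨l, by omega⟩ ⟨l + 1, h⟩ / M ⟨l + 1, h⟩ ⟨l, by omega⟩ else 1
  have hr : ∀ l, r l ≠ 0 := by
    intro l
    simp only [r]
    split_ifs with h
    · exact div_ne_zero (hM.2 _ _ (Or.inr rfl)) (hM.2 _ _ (Or.inl rfl))
    · exact one_ne_zero
  let k : ℕ → F := fun i => ∏ l ∈ Finset.range i, r l
  have hstep : ∀ i j : Fin (d + 1), (i : ℕ) + 1 = j → k i * M i j = M j i * k j := by
    intro i j hij
    have h1 : (⟨i + 1, by omega⟩ : Fin (d + 1)) = j := Fin.ext hij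
    have h2 := hM.2 j i (Or.inl (by omega))
    have h3 : r i = M i j / M j i := by
      simp only [r]
      rw [dif_pos (by omega)]
      simp only [h1, Fin.eta]
    rw [← hij]
    simp only [k]
    rw [Finset.prod_range_succ, h3]
    field_simp
  refine ⟨fun i => k i, fun i => Finset.prod_ne_zero_iff.2 fun l _ => hr l, ?_⟩
  ext i j
  rw [diagonal_mul, mul_diagonal, transpose_apply]
  by_cases h1 : (i : ℕ) + 1 = j
  · exact hstep i j h1
  by_cases h2 : (i : ℕ) = j + 1
  · have h := hstep j i h2.symm
    linear_combination -h
  by_cases h3 : (i : ℕ) = j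
  · rw [Fin.ext h3, mul_comm]
  rw [hM.1 i j h3 h2 h1, hM.1 j i (by omega) (by omega) (by omega)]
  simp

/-- Equivalently, Z ↦ S⁻¹ Zᵀ S is an antiautomorphism fixing both X and Y. The diagonal symmetrizer
of M also works for the diagonal matrix, and is carried back along P. -/
theorem DiagonalizesPair.exists_symmetrizer {X Y M : Matrix (Fin (d + 1)) (Fin (d + 1)) F} {P}
    {D : Fin (d + 1) → F} (h : DiagonalizesPair X Y P M D) :
    ∃ S : (Matrix (Fin (d + 1)) (Fin (d + 1)) F)ˣ, S.val * X = Xᵀ * S ∧ S.val * Y = Yᵀ * S := by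
  obtain ⟨hM, -, h1, h2⟩ := h
  obtain ⟨k, hk, hkM⟩ := hM.exists_symmetrizer
  have hkD : diagonal k * diagonal D = (diagonal D)ᵀ * diagonal k := by
    rw [diagonal_transpose, diagonal_mul_diagonal, diagonal_mul_diagonal]
    simp only [mul_comm]
  have hu : IsUnit (P⁻¹.valᵀ * diagonal k * P⁻¹.val) := by
    refine (((isUnit_transpose P⁻¹.val).2 P⁻¹.isUnit).mul ?_).mul P⁻¹.isUnit
    rw [isUnit_diagonal, Pi.isUnit_iff]
    exact fun i => isUnit_iff_ne_zero.2 (hk i)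
  refine ⟨hu.unit, ?_⟩
  have key : ∀ Z N : Matrix (Fin (d + 1)) (Fin (d + 1)) F, Z * P = P * N →
      diagonal k * N = Nᵀ * diagonal k → hu.unit.val * Z = Zᵀ * hu.unit.val := by
    intro Z N hZ hN
    have e1 : P⁻¹.val * Z = N * P⁻¹.val := by
      rw [Units.inv_mul_eq_iff_eq_mul, ← mul_assoc, ← hZ, Units.mul_inv_cancel_right]
    have e2 : Zᵀ * P⁻¹.valᵀ = P⁻¹.valᵀ * Nᵀ := by
      rw [← transpose_mul, e1, transpose_mul]
    rw [IsUnit.unit_spec, mul_assoc, e1, mul_assoc, ← mul_assoc (diagonal k), hN, ← mul_assoc,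
      ← mul_assoc, ← e2]
    simp only [mul_assoc]
  exact ⟨key X M h1 hkM, key Y _ h2 hkD⟩
end

/-! ### Standard orderings and reversed split forms. -/

section
variable {F : Type*} [Field F] {d : ℕ}

/-- If m is the last nonzero coordinate of an eigenvector for U_ii, row m gives U_mm = U_ii, so m =
i. Hence the eigenvectors themselves form a triangular matrix. -/
theorem Matrix.IsUpperTriangular.exists_mul_diagonal_diag
    {U : Matrix (Fin (d + 1)) (Fin (d + 1)) F} (hU : ∀ i j, j < i → U i j = 0)
    (hinj : Function.Injective fun i => U i i) :
    ∃ L : Matrix (Fin (d + 1)) (Fin (d + 1)) F, (∀ i j, j < i → L i j = 0) ∧ (∀ i, L i i ≠ 0) ∧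
      U * L = L * diagonal fun i => U i i := by
  have hex : ∀ i, ∃ v : Fin (d + 1) → F, v ≠ 0 ∧ U *ᵥ v = U i i • v := by
    intro i
    have hdet : (U - scalar (Fin (d + 1)) (U i i)).det = 0 := by
      rw [det_of_isUpperTriangular]
      · exact Finset.prod_eq_zero (Finset.mem_univ i) (by simp)
      · intro k l hkl
        have hkl' : l < k := hkl
        simp [hU k l hkl', diagonal_apply_ne _ hkl'.ne']
    obtain ⟨v, hv, h⟩ := exists_mulVec_eq_zero_iff.2 hdet
    refine ⟨v, hv, ?_⟩
    rw [sub_mulVec, sub_eq_zero] at h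
    rw [h]
    ext k
    simp [mulVec_diagonal]
  choose v hv0 hv using hex
  have htop : ∀ i m, v i m ≠ 0 → (∀ k, m < k → v i k = 0) → m = i := by
    intro i m hm hk
    have h := congrFun (hv i) m
    rw [mulVec, dotProduct, Finset.sum_eq_single m, Pi.smul_apply, smul_eq_mul] at h
    · exact hinj (mul_right_cancel₀ hm h)
    · intro k _ hkm
      rcases lt_or_gt_of_ne hkm with h1 | h1
      · rw [hU m k h1, zero_mul]
      · rw [hk k h1, mul_zero]
    · simp
  have hmax : ∀ i, v i i ≠ 0 ∧ ∀ k, i < k → v i k = 0 := by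
    intro i
    obtain ⟨k, hk⟩ := Function.ne_iff.1 (hv0 i)
    classical
    have hne : (Finset.univ.filter fun k => v i k ≠ 0).Nonempty := ⟨k, by simpa using hk⟩
    have h1 := Finset.max'_mem _ hne
    have h2 : ∀ l, Finset.max' _ hne < l → v i l = 0 := by
      intro l hl
      by_contra h
      exact absurd (Finset.le_max' _ l (by simpa using h)) (not_le.2 hl)
    have h3 := htop i _ (by simpa using h1) h2
    rw [h3] at h1 h2
    exact ⟨by simpa using h1, h2⟩
  refine ⟨of fun k i => v i k, fun i j h => (hmax j).2 i h, fun i => (hmax i).1, ?_⟩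
  ext k i
  rw [mul_diagonal]
  have := congrFun (hv i) k
  rw [Pi.smul_apply, smul_eq_mul, mul_comm] at this
  exact this

/-- If the pair `X, Y` can be symmetrized simultaneously, and in some coordinates `X` is upper
triangular and `Y` is upper Hessenberg with nonzero subdiagonal, then the diagonal of `X` in these
coordinates is a standard ordering. -/
theorem isStandardOrdering_of_isUpperTriangular
    {X Y U H : Matrix (Fin (d + 1)) (Fin (d + 1)) F} (S R : (Matrix (Fin (d + 1)) (Fin (d + 1)) F)ˣ)
    (hSX : S.val * X = Xᵀ * S) (hSY : S.val * Y = Yᵀ * S)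
    (hXR : X * R = R * U) (hYR : Y * R = R * H) (θ : ℕ → F)
    (hU : ∀ i j, j < i → U i j = 0) (hθ : ∀ i, U i i = θ i)
    (hinj : Function.Injective fun i => U i i)
    (hH : ∀ i j : Fin (d + 1), (j : ℕ) + 1 < i → H i j = 0)
    (hH1 : ∀ i j : Fin (d + 1), (i : ℕ) = j + 1 → H i j ≠ 0) :
    IsStandardOrdering d (toLin' X) (toLin' Y) θ := by
  obtain ⟨L, hL, hL1, hUL⟩ := Matrix.IsUpperTriangular.exists_mul_diagonal_diag hU hinj
  have hLt : L.IsUpperTriangular := fun i j h => hL i j h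
  have hLu : IsUnit L := by
    rw [isUnit_iff_isUnit_det, isUnit_iff_ne_zero, det_of_isUpperTriangular hLt]
    exact Finset.prod_ne_zero_iff.2 fun i _ => hL1 i
  obtain ⟨L, rfl⟩ := hLu
  have hLi : ∀ i j, j < i → L⁻¹.val i j = 0 := by
    let := L.invertible
    intro i j h
    rw [coe_units_inv]
    exact blockTriangular_inv_of_blockTriangular hLt h
  have hLi1 : ∀ i, L⁻¹.val i i ≠ 0 := by
    intro i h0
    have h : (L⁻¹.val * L.val) i i = 1 := by simp
    rw [mul_apply, Finset.sum_eq_single i, h0, zero_mul] at h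
    · exact zero_ne_one h
    · intro k _ hk
      rcases lt_or_gt_of_ne hk with h1 | h1
      · rw [hLi i k h1, zero_mul]
      · rw [hL k i h1, mul_zero]
    · simp
  have hG : ∀ i j : Fin (d + 1), (j : ℕ) + 1 < i → (H * L.val) i j = 0 := by
    intro i j hij
    rw [mul_apply]
    refine Finset.sum_eq_zero fun k _ => ?_
    rcases lt_or_ge j k with h | h
    · rw [hL k j h, mul_zero]
    · rw [hH i k (by have : (k : ℕ) ≤ j := h; omega), zero_mul]
  have hG1 : ∀ i j : Fin (d + 1), (i : ℕ) = j + 1 → (H * L.val) i j ≠ 0 := by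
    intro i j hij
    rw [mul_apply, Finset.sum_eq_single j]
    · exact mul_ne_zero (hH1 i j hij) (hL1 j)
    · intro k _ hk
      rcases lt_or_gt_of_ne hk with h | h
      · rw [hH i k (by have : (k : ℕ) < j := h; omega), zero_mul]
      · rw [hL k j h, mul_zero]
    · simp
  -- This is Y in the eigenbasis of X; triangular conjugation preserves the Hessenberg shape and the
  -- nonzero subdiagonal.
  set N := L⁻¹.val * (H * L.val) with hN
  have hN0 : ∀ i j : Fin (d + 1), (j : ℕ) + 1 < i → N i j = 0 := by
    intro i j hij
    rw [hN, mul_apply]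
    refine Finset.sum_eq_zero fun k _ => ?_
    rcases lt_or_ge k i with h | h
    · rw [hLi i k h, zero_mul]
    · rw [hG k j (by have : (i : ℕ) ≤ k := h; omega), mul_zero]
  have hN1 : ∀ i j : Fin (d + 1), (i : ℕ) = j + 1 → N i j ≠ 0 := by
    intro i j hij
    rw [hN, mul_apply, Finset.sum_eq_single i]
    · exact mul_ne_zero (hLi1 i) (hG1 i j hij)
    · intro k _ hk
      rcases lt_or_gt_of_ne hk with h | h
      · rw [hLi i k h, zero_mul]
      · rw [hG k j (by have : (i : ℕ) < k := h; omega), mul_zero]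
    · simp
  have hXQ : X * (R * L).val = (R * L).val * diagonal fun i => U i i := by
    rw [Units.val_mul, ← mul_assoc, hXR, mul_assoc, hUL, mul_assoc]
  have hYQ : Y * (R * L).val = (R * L).val * N := by
    rw [Units.val_mul, ← mul_assoc, hYR, mul_assoc, hN, mul_assoc, Units.mul_inv_cancel_left]
  generalize R * L = Q at hXQ hYQ
  -- in the eigenbasis the symmetrizer is diagonal
  let K := Q.valᵀ * S.val * Q.val
  have hKu : IsUnit K := ((isUnit_transpose Q.val).2 Q.isUnit |>.mul S.isUnit).mul Q.isUnit
  have hK : ∀ Z W : Matrix (Fin (d + 1)) (Fin (d + 1)) F, S.val * Z = Zᵀ * S →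
      Z * Q.val = Q.val * W → K * W = Wᵀ * K := by
    intro Z W h1 h2
    have h3 : Q.valᵀ * Zᵀ = Wᵀ * Q.valᵀ := by rw [← transpose_mul, h2, transpose_mul]
    calc K * W = Q.valᵀ * (S.val * (Q.val * W)) := by simp only [K, mul_assoc]
      _ = (Q.valᵀ * Zᵀ) * S * Q := by rw [← h2, ← mul_assoc S.val, h1]; simp only [mul_assoc]
      _ = Wᵀ * K := by rw [h3]; simp only [K, mul_assoc]
  have hKD := hK X _ hSX hXQ
  have hKN := hK Y _ hSY hYQ
  have hoff : ∀ i j, i ≠ j → K i j = 0 := by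
    intro i j hij
    have h := congrFun (congrFun hKD i) j
    rw [diagonal_transpose, mul_diagonal, diagonal_mul] at h
    have h1 : (U i i - U j j) * K i j = 0 := by linear_combination -h
    exact (mul_eq_zero.1 h1).resolve_left (sub_ne_zero.2 fun h => hij (hinj h))
  have hKdiag : K = diagonal fun i => K i i := by
    ext i j
    by_cases h : i = j
    · rw [h, diagonal_apply_eq]
    · rw [hoff i j h, diagonal_apply_ne _ h]
  have hK0 : ∀ i, K i i ≠ 0 := by
    rw [hKdiag, isUnit_diagonal, Pi.isUnit_iff] at hKu
    exact fun i => (hKu i).ne_zero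
  have hsym : ∀ i j, K i i * N i j = N j i * K j j := by
    intro i j
    have h := congrFun (congrFun hKN i) j
    rw [hKdiag, diagonal_mul, mul_diagonal, transpose_apply] at h
    exact h
  -- The zero pattern of `N` is symmetric, so the Hessenberg shape becomes tridiagonal.
  have hsym0 : ∀ i j, N i j = 0 → N j i = 0 := by
    intro i j h
    have h1 := hsym i j
    rw [h, mul_zero] at h1
    exact (mul_eq_zero.1 h1.symm).resolve_right (hK0 j)
  have hNirr : IsIrreducibleTridiagonal N := by
    refine ⟨fun i j h1 h2 h3 => ?_, fun i j h => ?_⟩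
    · rcases Nat.lt_or_ge (i : ℕ) j with h | h
      · exact hsym0 j i (hN0 j i (by omega))
      · exact hN0 i j (by omega)
    · rcases h with h | h
      · exact hN1 i j h
      · exact fun h0 => hN1 j i h.symm (hsym0 i j h0)
  obtain ⟨v, hv, hvM⟩ := exists_basis_toMatrix_toLin' Q
  refine ⟨fun i j hi hj h => ?_, v, fun i => ⟨?_, v.ne_zero i⟩, ?_⟩
  · have h1 : (⟨i, by omega⟩ : Fin (d + 1)) = ⟨j, by omega⟩ := hinj (by simp only [hθ, h])
    exact congrArg Fin.val h1
  · rw [Module.End.mem_eigenspace_iff, toLin'_apply, hv, ← hθ]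
    ext k
    have h := congrFun (congrFun hXQ k) i
    rw [mul_diagonal] at h
    rw [Pi.smul_apply, smul_eq_mul, mul_comm]
    exact h
  · rw [hvM Y N hYQ]
    exact hNirr

theorem isFirstSplitSequence_of_mul_eq_mul {X Y : Matrix (Fin (d + 1)) (Fin (d + 1)) F}
    (R : (Matrix (Fin (d + 1)) (Fin (d + 1)) F)ˣ) {θ θs φ : ℕ → F}
    (hX : X * R = R * lowerBidiagonalMatrix d θ) (hY : Y * R = R * upperBidiagonalMatrix d θs φ) :
    IsFirstSplitSequence d (toLin' X) (toLin' Y) θ θs φ := by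
  obtain ⟨u, -, hu⟩ := exists_basis_toMatrix_toLin' R
  exact ⟨u, hu _ _ hX, hu _ _ hY⟩

theorem submatrix_rev_tridiagonalMatrix {x y z x' y' z' : ℕ → F}
    (hx : ∀ i ≤ d, x (d - i) = x' i) (hy : ∀ i, 1 ≤ i → i ≤ d → z (d + 1 - i) = y' i)
    (hz : ∀ i, 1 ≤ i → i ≤ d → y (d + 1 - i) = z' i) :
    (tridiagonalMatrix d x y z).submatrix Fin.rev Fin.rev = tridiagonalMatrix d x' y' z' := by
  ext i j
  obtain ⟨i, hi⟩ := i
  obtain ⟨j, hj⟩ := j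
  simp only [submatrix_apply, tridiagonalMatrix, of_apply, Fin.val_rev]
  split_ifs <;> try (exfalso; omega)
  · rw [← hx i (by omega)]; congr 1; omega
  · rw [← hz i (by omega) (by omega)]; congr 1; omega
  · rw [← hy j (by omega) (by omega)]; congr 1; omega
  · rfl

/-- Transposing and reversing a split form of a symmetrizable pair gives the split form for both
eigenvalue sequences reversed. -/
theorem IsFirstSplitSequence.of_symmetrizer {X Y : Matrix (Fin (d + 1)) (Fin (d + 1)) F}
    (S R : (Matrix (Fin (d + 1)) (Fin (d + 1)) F)ˣ)
    (hSX : S.val * X = Xᵀ * S) (hSY : S.val * Y = Yᵀ * S) {θ θs φ θ' θs' φ' : ℕ → F}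
    (hX : X * R = R * lowerBidiagonalMatrix d θ) (hY : Y * R = R * upperBidiagonalMatrix d θs φ)
    (hθ : ∀ i ≤ d, θ (d - i) = θ' i) (hθs : ∀ i ≤ d, θs (d - i) = θs' i)
    (hφ : ∀ i, 1 ≤ i → i ≤ d → φ (d + 1 - i) = φ' i) :
    IsFirstSplitSequence d (toLin' X) (toLin' Y) θ' θs' φ' := by
  -- With Q = Rᵀ S, the coordinates Q⁻¹ replace each matrix by its transpose; the reversal `J` then
  -- restores the lower and upper bidiagonal shapes.
  let Q : (Matrix (Fin (d + 1)) (Fin (d + 1)) F)ˣ :=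
    (((isUnit_transpose R.val).2 R.isUnit).mul S.isUnit).unit
  let J : Matrix (Fin (d + 1)) (Fin (d + 1)) F := (1 : Matrix _ _ F).submatrix id Fin.rev
  have hmulJ : ∀ W : Matrix (Fin (d + 1)) (Fin (d + 1)) F, W * J = W.submatrix id Fin.rev := by
    intro W
    ext i j
    simp [J, mul_apply, one_apply]
  have hJ : ∀ W : Matrix (Fin (d + 1)) (Fin (d + 1)) F, W * J = J * W.submatrix Fin.rev Fin.rev := by
    intro W
    have e2 : J = (1 : Matrix _ _ F).submatrix Fin.rev id := by
      ext i j
      simp only [J, submatrix_apply, one_apply, id]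
      exact if_congr Fin.rev_eq_iff.symm rfl rfl
    rw [hmulJ, e2]
    ext i j
    simp [mul_apply, one_apply]
  have hJJ : J * J = 1 := by
    rw [hmulJ]
    ext i j
    change (1 : Matrix (Fin (d + 1)) (Fin (d + 1)) F) i j.rev.rev = _
    rw [Fin.rev_rev]
  let Ju : (Matrix (Fin (d + 1)) (Fin (d + 1)) F)ˣ := ⟨J, J, hJJ, hJJ⟩
  have key : ∀ Z W : Matrix (Fin (d + 1)) (Fin (d + 1)) F, S.val * Z = Zᵀ * S → Z * R = R * W →
      Z * (Q⁻¹ * Ju).val = (Q⁻¹ * Ju).val * Wᵀ.submatrix Fin.rev Fin.rev := by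
    intro Z W h1 h2
    have h3 : Q.val * Z = Wᵀ * Q.val := by
      have h4 : R.valᵀ * Zᵀ = Wᵀ * R.valᵀ := by rw [← transpose_mul, h2, transpose_mul]
      simp only [Q, IsUnit.unit_spec]
      rw [mul_assoc, h1, ← mul_assoc, h4, mul_assoc]
    have h5 : Z * Q⁻¹.val = Q⁻¹.val * Wᵀ := by
      rw [Units.eq_inv_mul_iff_mul_eq, ← mul_assoc, h3, Units.mul_inv_cancel_right]
    rw [Units.val_mul, ← mul_assoc, h5, mul_assoc, mul_assoc]
    congr 1
    exact hJ _
  refine isFirstSplitSequence_of_mul_eq_mul (Q⁻¹ * Ju) ?_ ?_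
  · rw [key _ _ hSX hX, lowerBidiagonalMatrix, tridiagonalMatrix_transpose,
      submatrix_rev_tridiagonalMatrix (x' := θ') (y' := fun _ => 0) (z' := fun _ => 1) hθ
        (fun _ _ _ => rfl) (fun _ _ _ => rfl), lowerBidiagonalMatrix]
  · rw [key _ _ hSY hY, upperBidiagonalMatrix, tridiagonalMatrix_transpose,
      submatrix_rev_tridiagonalMatrix (x' := θs') (y' := φ') (z' := fun _ => 0) hθs
        hφ (fun _ _ _ => rfl), upperBidiagonalMatrix]
end

/-! ### The split basis and the parameter array. -/

theorem IsLBTDLeonardPair.exists_units_intertwining {F : Type*} [Field F] {d : ℕ}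
    {q α αs a a' b b' c : F} (hq0 : q ≠ 0) (hq : ∀ n : ℕ, 0 < n → q ^ n ≠ 1) (hc : c ≠ 0)
    {θ x y z θs φ : ℕ → F}
    (hθ : ∀ i : ℕ, i ≤ d →
      θ i = α + a * q ^ (2 * (i : ℤ) - d) + a' * q ^ ((d : ℤ) - 2 * i))
    (hx : ∀ i : ℕ, i ≤ d →
      x i = αs + (b + b') * q ^ ((d : ℤ) - 2 * i)
        + a' * c * q ^ ((d : ℤ) - 2 * i)
          * (q ^ ((d : ℤ) + 1) + q ^ (-(d : ℤ) - 1)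
            - q ^ ((d : ℤ) - 2 * i - 1) - q ^ ((d : ℤ) - 2 * i + 1)))
    (hy : ∀ i : ℕ, 1 ≤ i → i ≤ d →
      y i = (q ^ (i : ℤ) - q ^ (-(i : ℤ))) * (q ^ ((d : ℤ) - i + 1) - q ^ ((i : ℤ) - d - 1))
        * (b - a' * c * q ^ ((d : ℤ) - 2 * i + 1))
        * (b' - a' * c * q ^ ((d : ℤ) - 2 * i + 1)) * c⁻¹)
    (hz : ∀ i : ℕ, 1 ≤ i → i ≤ d →
      z i = -c * q ^ ((d : ℤ) - 2 * i + 1))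
    (hpair : IsLBTDLeonardPair (lowerBidiagonalMatrix d θ) (tridiagonalMatrix d x y z))
    (hθs : ∀ i : ℕ, i ≤ d →
      θs i = αs + b * q ^ (2 * (i : ℤ) - d) + b' * q ^ ((d : ℤ) - 2 * i))
    (hφ : ∀ i : ℕ, 1 ≤ i → i ≤ d →
      φ i = (q ^ (i : ℤ) - q ^ (-(i : ℤ))) * (q ^ ((d : ℤ) - i + 1) - q ^ ((i : ℤ) - d - 1))
        * (b - a' * c * q ^ ((d : ℤ) - 2 * i + 1))
        * (b' - a * c * q ^ (2 * (i : ℤ) - d - 1)) * c⁻¹) :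
    ∃ T : (Matrix (Fin (d + 1)) (Fin (d + 1)) F)ˣ,
      lowerBidiagonalMatrix d θ * T = T * lowerBidiagonalMatrix d θ ∧
      tridiagonalMatrix d x y z * T = T * upperBidiagonalMatrix d θs φ := by
  -- This is a factor of y_{i+1}, a nonzero superdiagonal entry of A*.
  have hB : ∀ i : ℕ, i < d → b' - a' * c * q ^ ((d : ℤ) - 2 * i - 1) ≠ 0 := by
    intro i hi h0
    have h := hpair.1.2.2 ⟨i, by omega⟩ ⟨i + 1, by omega⟩ (Or.inr rfl)
    have e : (d : ℤ) - 2 * (i + 1 : ℕ) + 1 = (d : ℤ) - 2 * i - 1 := by push_cast; ring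
    simp only [tridiagonalMatrix, of_apply, left_eq_add, one_ne_zero, if_false, if_true] at h
    rw [hy _ (by omega) (by omega), e, h0] at h
    simp at h
  have hA := lowerBidiagonal_mul_splitEntry hq0 hq hc hθ hB
  have hAs := tridiagonal_mul_splitEntry hq0 hq hc hx hy hz hθs hφ hB
  obtain ⟨⟨P, M, D, hP⟩, -⟩ := hpair.2.exists_diagonalizesPair
  -- One nonzero entry suffices. The diagonal contains factors b' - a c q^(2k+1-d), not known in
  -- advance to be nonzero, so triangularity alone does not give invertibility.
  have hT : (Matrix.of fun j i : Fin (d + 1) => splitEntry d q a a' b' c j i) ≠ 0 := by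
    intro h
    have h1 := congrFun (congrFun h 0) 0
    rw [of_apply, Fin.val_zero, splitEntry_zero_zero] at h1
    exact one_ne_zero h1
  obtain ⟨T, hT⟩ := hP.isUnit_of_intertwines hT hA hAs
  exact ⟨T, hT ▸ hA, hT ▸ hAs⟩

theorem proposition1p7 {F : Type*} [Field F] [IsAlgClosed F] (d : ℕ)
    (q : F) (hq0 : q ≠ 0) (hq : ∀ n : ℕ, 0 < n → q ^ n ≠ 1)
    (α αs a a' b b' c : F) (hc : c ≠ 0)
    (θ x y z θs φ ϕ : ℕ → F)
    (hθ : ∀ i : ℕ, i ≤ d →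
      θ i = α + a * q ^ (2 * (i : ℤ) - d) + a' * q ^ ((d : ℤ) - 2 * i))
    (hx : ∀ i : ℕ, i ≤ d →
      x i = αs + (b + b') * q ^ ((d : ℤ) - 2 * i)
        + a' * c * q ^ ((d : ℤ) - 2 * i)
          * (q ^ ((d : ℤ) + 1) + q ^ (-(d : ℤ) - 1)
            - q ^ ((d : ℤ) - 2 * i - 1) - q ^ ((d : ℤ) - 2 * i + 1)))
    (hy : ∀ i : ℕ, 1 ≤ i → i ≤ d →
      y i = (q ^ (i : ℤ) - q ^ (-(i : ℤ))) * (q ^ ((d : ℤ) - i + 1) - q ^ ((i : ℤ) - d - 1))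
        * (b - a' * c * q ^ ((d : ℤ) - 2 * i + 1))
        * (b' - a' * c * q ^ ((d : ℤ) - 2 * i + 1)) * c⁻¹)
    (hz : ∀ i : ℕ, 1 ≤ i → i ≤ d →
      z i = -c * q ^ ((d : ℤ) - 2 * i + 1))
    (hpair : IsLBTDLeonardPair (lowerBidiagonalMatrix d θ) (tridiagonalMatrix d x y z))
    (hθs : ∀ i : ℕ, i ≤ d →
      θs i = αs + b * q ^ (2 * (i : ℤ) - d) + b' * q ^ ((d : ℤ) - 2 * i))
    (hφ : ∀ i : ℕ, 1 ≤ i → i ≤ d →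
      φ i = (q ^ (i : ℤ) - q ^ (-(i : ℤ))) * (q ^ ((d : ℤ) - i + 1) - q ^ ((i : ℤ) - d - 1))
        * (b - a' * c * q ^ ((d : ℤ) - 2 * i + 1))
        * (b' - a * c * q ^ (2 * (i : ℤ) - d - 1)) * c⁻¹)
    (hϕ : ∀ i : ℕ, 1 ≤ i → i ≤ d →
      ϕ i = (q ^ (i : ℤ) - q ^ (-(i : ℤ))) * (q ^ ((d : ℤ) - i + 1) - q ^ ((i : ℤ) - d - 1))
        * (b - a * c * q ^ ((d : ℤ) - 2 * i + 1))
        * (b' - a' * c * q ^ (2 * (i : ℤ) - d - 1)) * c⁻¹) :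
    IsParameterArray d (Matrix.toLin' (lowerBidiagonalMatrix d θ))
      (Matrix.toLin' (tridiagonalMatrix d x y z)) θ θs φ ϕ := by

  obtain ⟨T, hTA, hTB⟩ := hpair.exists_units_intertwining hq0 hq hc hθ hx hy hz hθs hφ
  -- The formulas for x and y are symmetric in b and b', so the same pair has a second split form
  -- with θ* reversed.
  obtain ⟨T', hTA', hTB'⟩ := hpair.exists_units_intertwining (b := b') (b' := b)
    (θs := fun i => θs (d - i)) (φ := fun i => ϕ (d + 1 - i)) hq0 hq hc hθ
    (fun i hi => by rw [hx i hi, add_comm b b'])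
    (fun i h1 h2 => by rw [hy i h1 h2]; ring) hz
    (fun i hi => by
      have e1 : 2 * ((d - i : ℕ) : ℤ) - d = d - 2 * i := by omega
      have e2 : (d : ℤ) - 2 * ((d - i : ℕ) : ℤ) = 2 * i - d := by omega
      rw [hθs _ (by omega), e1, e2]; ring)
    (fun i h1 h2 => by
      have e1 : ((d + 1 - i : ℕ) : ℤ) = d - i + 1 := by omega
      have e2 : -((d : ℤ) - i + 1) = i - d - 1 := by ring
      have e3 : (d : ℤ) - (d - i + 1) + 1 = i := by ring
      have e4 : (d : ℤ) - i + 1 - d - 1 = -i := by ring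
      have e5 : (d : ℤ) - 2 * (d - i + 1) + 1 = 2 * i - d - 1 := by ring
      have e6 : 2 * ((d : ℤ) - i + 1) - d - 1 = d - 2 * i + 1 := by ring
      rw [hϕ _ (by omega) (by omega), e1, e2, e3, e4, e5, e6]; ring)
  obtain ⟨⟨P, M, D, hP⟩, P', M', D', hP'⟩ := hpair.2.exists_diagonalizesPair
  obtain ⟨S, hSA, hSB⟩ := hP.exists_symmetrizer
  have hlower : ∀ i j : Fin (d + 1), i < j → lowerBidiagonalMatrix d θ i j = 0 := by
    intro i j hij
    have hij' : (i : ℕ) < j := hij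
    exact hpair.1.1.1 i j (by omega) (by omega)
  -- The triangular and diagonal forms have the same characteristic polynomial, so distinctness
  -- passes from the latter to θ.
  have hinjA : Function.Injective fun i : Fin (d + 1) => θ i := by
    refine hP'.injective.of_prod_X_sub_C_eq ?_
    rw [← charpoly_diagonal D', ← charpoly_eq_of_mul_eq_mul P' hP'.right, ← charpoly_transpose,
      charpoly_of_isUpperTriangular]
    · simp [lowerBidiagonalMatrix, tridiagonalMatrix]
    · exact fun i j hij => hlower j i hij
  have hupper : ∀ i j : Fin (d + 1), j < i → upperBidiagonalMatrix d θs φ i j = 0 := by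
    intro i j hij
    have hij' : (j : ℕ) < i := hij
    simp only [upperBidiagonalMatrix, tridiagonalMatrix, of_apply, ite_self]
    rw [if_neg (by omega), if_neg (by omega)]
  have hinjB : Function.Injective fun i : Fin (d + 1) => θs i := by
    refine hP.injective.of_prod_X_sub_C_eq ?_
    rw [← charpoly_diagonal D, ← charpoly_eq_of_mul_eq_mul P hP.right,
      charpoly_eq_of_mul_eq_mul T hTB, charpoly_of_isUpperTriangular]
    · simp [upperBidiagonalMatrix, tridiagonalMatrix]
    · exact fun i j hij => hupper i j hij
  have hS : ∀ Z : Matrix (Fin (d + 1)) (Fin (d + 1)) F, S.val * Z = Zᵀ * S →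
      Z * S⁻¹.val = S⁻¹.val * Zᵀ := by
    intro Z hZ
    rw [Units.eq_inv_mul_iff_mul_eq, ← mul_assoc, hZ, Units.mul_inv_cancel_right]
  refine ⟨?_, ?_, isFirstSplitSequence_of_mul_eq_mul T hTA hTB, ?_⟩
  -- In the coordinates S⁻¹ both matrices are transposed, which makes A upper triangular and keeps
  -- A* irreducible tridiagonal.
  · refine isStandardOrdering_of_isUpperTriangular S S⁻¹ hSA hSB (hS _ hSA) (hS _ hSB) θ ?_ ?_ ?_
      ?_ ?_
    · exact fun i j hij => hlower j i hij
    · simp [lowerBidiagonalMatrix, tridiagonalMatrix]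
    · simpa [lowerBidiagonalMatrix, tridiagonalMatrix] using hinjA
    · exact fun i j hij => hpair.1.2.1 j i (by omega) (by omega) (by omega)
    · exact fun i j hij => hpair.1.2.2 j i (Or.inr hij.symm)
  · refine isStandardOrdering_of_isUpperTriangular S T hSB hSA hTB hTA θs hupper ?_ ?_ ?_ ?_
    · simp [upperBidiagonalMatrix, tridiagonalMatrix]
    · simpa [upperBidiagonalMatrix, tridiagonalMatrix] using hinjB
    · exact fun i j hij => hpair.1.1.1 i j (by omega) (by omega)
    · intro i j hij
      rw [hpair.1.1.2 i j hij]
      exact one_ne_zero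
  · exact IsFirstSplitSequence.of_symmetrizer S T' hSA hSB hTA' hTB' (fun _ _ => rfl)
      (fun i hi => by simp only [Nat.sub_sub_self hi])
      (fun i h1 h2 => by simp only [Nat.sub_sub_self (by omega : i ≤ d + 1)])
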